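/- A partition $\pi$ of $[n]=\{1,\dots,n\}$ is represented by the graph on $[n]$ whose edges are the pairs $(i,j)$, $i<j$, such that $i$ and $j$ belong to the same block of $\pi$ and no element of that block lies strictly between them. Let $\mathrm{ed}(\pi)$ be the number of edges of $\pi$, let $\mathrm{cr}(\pi)$ be the number of crossings, i.e. of pairs of edges $(i_1,j_1),(i_2,j_2)$ with $i_1<i_2<j_1<j_2$, and let $\mathrm{ne}(\pi)$ be the number of nestings, i.e. of pairs of edges $(i_1,j_1),(i_2,j_2)$ with $i_1<i_2<j_2<j_1$. Let $\Pi_n$ be the set of partitions of $[n]$ and $$E_n(v,q)=\sum_{\pi\in\Pi_n}q^{\mathrm{cr}(\pi)+\mathrm{ne}(\pi)}\,v^{\mathrm{ed}(\pi)}\qquad(n\ge 0).$$ **Corollary.** Let $v,q$ be elements of a commutative ring (for example, indeterminates). As a formal power series in $z$, the generating function of the $E_n(v,q)$ has the J-fraction expansion $$\sum_{n\ge0}E_n(v,q)\,z^n=\cfrac{1}{1-z-\cfrac{v z^2}{1-(1+v)z-\cfrac{2qv z^2}{1-(1+2qv)z-\cfrac{3q^2v z^2}{1-(1+3q^2v)z-\cfrac{4q^3v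 z^2}{\ddots}}}}}$$ in which the denominator at level $k\ge0$ begins with $1-(1+kq^{k-1}v)z$ (which is $1-z$ for $k=0$) and the partial numerator between levels $k$ and $k+1$ is $(k+1)q^kv z^2$. Here the infinite continued fraction denotes the limit of its finite truncations in the sense of formal power series: for each $n$, the coefficient of $z^n$ in the truncation after level $m$ equals $E_n(v,q)$ for all sufficiently large $m$. -/

import Mathlib

open PowerSeries Filter

namespace SetPartition

/-- The set `Π_n` of partitions of `[n] = {1, …, n}` (into nonempty, pairwise disjoint blocks). -/
abbrev Part (n : ℕ) : Type := Finpartition (Finset.Icc 1 n)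

/-- The edges (arcs) of the graph of a set partition: the pairs `(i, j)` with `i < j` such that
`i` and `j` are consecutive elements of one block. -/
def edges {n : ℕ} (π : Part n) : Finset (ℕ × ℕ) :=
  (Finset.Icc 1 n ×ˢ Finset.Icc 1 n).filter fun e =>
    e.1 < e.2 ∧ ∃ B ∈ π.parts, e.1 ∈ B ∧ e.2 ∈ B ∧ ∀ k ∈ B, ¬ (e.1 < k ∧ k < e.2)

/-- `ed π`, the number of edges. -/
def ed {n : ℕ} (π : Part n) : ℕ := (edges π).card

/-- `cr π`, the number of crossings: pairs of edges `(i₁, j₁)`, `(i₂, j₂)` with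
`i₁ < i₂ < j₁ < j₂`. -/
def cr {n : ℕ} (π : Part n) : ℕ :=
  ((edges π ×ˢ edges π).filter fun p =>
    p.1.1 < p.2.1 ∧ p.2.1 < p.1.2 ∧ p.1.2 < p.2.2).card

/-- `ne π`, the number of nestings: pairs of edges `(i₁, j₁)`, `(i₂, j₂)` with
`i₁ < i₂ < j₂ < j₁`. -/
def ne {n : ℕ} (π : Part n) : ℕ :=
  ((edges π ×ˢ edges π).filter fun p =>
    p.1.1 < p.2.1 ∧ p.2.1 < p.2.2 ∧ p.2.2 < p.1.2).card

/-- `E_n(v, q) = ∑_{π ∈ Π_n} q ^ (cr π + ne π) * v ^ ed π`. -/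
def E {R : Type*} [CommRing R] (n : ℕ) (v q : R) : R :=
  ∑ π : Part n, q ^ (cr π + ne π) * v ^ ed π

end SetPartition

namespace JFraction

/-- The finite continued fraction with `m + 1` levels that starts at level `k`:
`1 / (1 - b k z - a k z² / (1 - b (k+1) z - a (k+1) z² / (⋯ / (1 - b (k+m) z))))`,
a formal power series in `z = X`. Every denominator has constant coefficient `1`, so it is
invertible, and `invOfUnit _ 1` is its inverse (see `denom_mul_conv`). -/
noncomputable def conv {R : Type*} [CommRing R] (b a : ℕ → R) : ℕ → ℕ → R⟦X⟧
  | 0, k => invOfUnit (1 - C (b k) * X) 1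
  | m + 1, k => invOfUnit (1 - C (b k) * X - C (a k) * X ^ 2 * conv b a m (k + 1)) 1

theorem denom_mul_conv_zero {R : Type*} [CommRing R] (b a : ℕ → R) (k : ℕ) :
    (1 - C (b k) * X) * conv b a 0 k = 1 := by
  rw [conv]
  exact mul_invOfUnit _ _ (by simp)

theorem denom_mul_conv {R : Type*} [CommRing R] (b a : ℕ → R) (m k : ℕ) :
    (1 - C (b k) * X - C (a k) * X ^ 2 * conv b a m (k + 1)) * conv b a (m + 1) k = 1 := by
  rw [conv]
  exact mul_invOfUnit _ _ (by simp)

/-- `F` is the value of the infinite J-fraction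
`1 / (1 - b 0 z - a 0 z² / (1 - b 1 z - a 1 z² / (1 - b 2 z - ⋯)))`: its convergents tend to `F`
in the `z`-adic sense, i.e. every coefficient is eventually that of `F`. -/
def HasJFraction {R : Type*} [CommRing R] (F : R⟦X⟧) (b a : ℕ → R) : Prop :=
  ∀ n : ℕ, ∀ᶠ m in atTop, coeff n (conv b a m 0) = coeff n F

end JFraction

/-!
Detaching `n + 1` from a partition of `[n + 1]` leaves a partition of `[n]`, and either `n + 1` was
a singleton or it was joined by an arc to the maximum `i` of a block. In the second case the
crossings and nestings that get lost are those of the arc `(i, n + 1)` with the arcs that end after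
`i`; let `c i` be their number. Let `Φ n` be the sum over the partitions of `[n]` of
`q ^ (cr + ne) * v ^ ed * ∏ i, (1 + q ^ c i * t)`, where `i` runs over the maxima of the blocks. The
product rule gives `Φ (n + 1) (t) = (1 + t) * (Φ n (t) + v * (Φ n)' (q * t))`, which in terms of the
coefficients of `t ^ k` is the recursion for weighted Motzkin paths that end at level `k`. Finally,
`E n v q` is the constant coefficient of `Φ n`, and a J-fraction enumerates the Motzkin paths that
end at level `0`.
-/

namespace JFraction

/-- The total weight of the Motzkin paths with `n` steps from level `0` to level `k`, where a rise
has weight `1`, a level step at level `j` has weight `b j`, and a fall from level `j + 1` to level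
`j` has weight `a j`; the recursion removes the last step. -/
def motzkin {R : Type*} [Semiring R] (b a : ℕ → R) : ℕ → ℕ → R
  | 0, 0 => 1
  | 0, _ + 1 => 0
  | n + 1, 0 => b 0 * motzkin b a n 0 + a 0 * motzkin b a n 1
  | n + 1, k + 1 =>
    motzkin b a n k + b (k + 1) * motzkin b a n (k + 1) + a (k + 1) * motzkin b a n (k + 2)

variable {R : Type*} [CommRing R] (b a : ℕ → R)

/-- The generating function of the Motzkin paths of height at most `m` that end at level `k`:
cutting such a path at its last visits to the levels `0, …, k - 1` gives `k` rises and, for each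
`j ≤ k`, an excursion above level `j`, which is counted by a convergent that starts at level `j`. -/
noncomputable def pathSeries (m k : ℕ) : R⟦X⟧ :=
  X ^ k * ∏ j ∈ Finset.range (k + 1), conv b a (m - j) j

theorem pathSeries_zero (m : ℕ) : pathSeries b a m 0 = conv b a m 0 := by
  simp [pathSeries]

theorem pathSeries_succ (m k : ℕ) :
    pathSeries b a m (k + 1) = X * pathSeries b a m k * conv b a (m - (k + 1)) (k + 1) := by
  rw [pathSeries, pathSeries, Finset.prod_range_succ]
  ring

theorem constantCoeff_conv (m k : ℕ) : constantCoeff (conv b a m k) = 1 := by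
  cases m <;> simp [conv]

theorem conv_succ_eq (m k : ℕ) :
    conv b a (m + 1) k = 1 + X * (C (b k) * conv b a (m + 1) k +
      C (a k) * (X * conv b a (m + 1) k * conv b a m (k + 1))) := by
  linear_combination denom_mul_conv b a m k

theorem pathSeries_zero_eq {m : ℕ} (hm : 0 < m) :
    pathSeries b a m 0 = 1 + X * (C (b 0) * pathSeries b a m 0 +
      C (a 0) * pathSeries b a m 1) := by
  obtain ⟨m, rfl⟩ := Nat.exists_eq_add_one.2 hm
  simpa [pathSeries_succ, pathSeries_zero] using conv_succ_eq b a m 0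

theorem pathSeries_succ_eq {m k : ℕ} (hm : k + 1 < m) :
    pathSeries b a m (k + 1) = X * (pathSeries b a m k +
      C (b (k + 1)) * pathSeries b a m (k + 1) + C (a (k + 1)) * pathSeries b a m (k + 2)) := by
  obtain ⟨d, hd⟩ : ∃ d, m - (k + 1) = d + 1 := Nat.exists_eq_add_one.2 (by omega)
  have hd' : m - (k + 1 + 1) = d := by omega
  rw [pathSeries_succ b a m (k + 1), pathSeries_succ, hd, hd']
  linear_combination X * pathSeries b a m k * conv_succ_eq b a d (k + 1)

theorem coeff_pathSeries {m n k : ℕ} (h : n + k ≤ m) :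
    coeff n (pathSeries b a m k) = motzkin b a n k := by
  induction n generalizing k with
  | zero => cases k <;> simp [pathSeries_zero, pathSeries_succ, constantCoeff_conv, motzkin]
  | succ n ih =>
    cases k with
    | zero =>
      rw [pathSeries_zero_eq b a (by omega), motzkin, ← ih (by omega), ← ih (by omega)]
      simp [coeff_succ_X_mul, coeff_one]
    | succ k =>
      rw [pathSeries_succ_eq b a (by omega), motzkin, ← ih (by omega), ← ih (by omega),
        ← ih (by omega)]
      simp [coeff_succ_X_mul]

theorem hasJFraction_motzkin : HasJFraction (mk fun n => motzkin b a n 0) b a := by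
  intro n
  filter_upwards [eventually_ge_atTop n] with m hm
  rw [coeff_mk, ← pathSeries_zero, coeff_pathSeries b a (by omega)]

end JFraction

namespace SetPartition

open Finset Relation

/-- Two points are related if one of them can be reached from the other. If every point has at most
one successor and at most one predecessor, then this is an equivalence relation. -/
def chainSetoid {α : Type*} {r : α → α → Prop} (hr : Relator.BiUnique r) : Setoid α where
  r i j := ReflTransGen r i j ∨ ReflTransGen r j i
  iseqv.refl _ := .inl .refl
  iseqv.symm := Or.symm
  iseqv.trans := by
    rintro i j k (hij | hji) (hjk | hkj)
    · exact .inl (hij.trans hjk)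
    · have hswap : Relator.RightUnique (Function.swap r) := fun _ _ _ h h' => hr.1 h h'
      simpa only [reflTransGen_swap, or_comm] using
        hij.swap.total_of_right_unique hswap hkj.swap
    · exact hji.total_of_right_unique hr.2 hjk
    · exact .inr (hkj.trans hji)

/-- The arc sets on `[n]`: sets of pairs `(i, j)`, `i < j`, such that every point opens at most one
arc and closes at most one arc. They are the sets of edges of the partitions of `[n]`. -/
structure IsArcSet (n : ℕ) (A : Finset (ℕ × ℕ)) : Prop where
  subset : A ⊆ Icc 1 n ×ˢ Icc 1 n
  lt : ∀ {i j}, (i, j) ∈ A → i < j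
  biUnique : Relator.BiUnique fun i j => (i, j) ∈ A

section Edges

variable {n i j : ℕ} {π π' : Part n}

theorem mem_edges :
    (i, j) ∈ edges π ↔ i < j ∧ j ∈ π.part i ∧ ∀ k ∈ π.part i, ¬ (i < k ∧ k < j) := by
  simp only [edges, mem_filter, mem_product]
  constructor
  · rintro ⟨_, hij, B, hB, hi, hj, hk⟩
    obtain rfl := π.part_eq_of_mem hB hi
    exact ⟨hij, hj, hk⟩
  · rintro ⟨hij, hj, hk⟩
    have hi : i ∈ Icc 1 n := π.part_nonempty.1 ⟨j, hj⟩
    exact ⟨⟨hi, π.part_subset i hj⟩, hij, _, π.part_mem.2 hi, π.mem_part hi, hj, hk⟩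

theorem part_eq_of_mem_edges (h : (i, j) ∈ edges π) : π.part i = π.part j := by
  have hj := (mem_edges.1 h).2.1
  exact (π.part_eq_of_mem (π.part_mem.2 (π.part_nonempty.1 ⟨j, hj⟩)) hj).symm

theorem isArcSet_edges (π : Part n) : IsArcSet n (edges π) where
  subset := filter_subset _ _
  lt h := (mem_edges.1 h).1
  biUnique := by
    constructor
    · intro i i' j h h'
      have hpart := (part_eq_of_mem_edges h).trans (part_eq_of_mem_edges h').symm
      obtain ⟨hij, hj, hmin⟩ := mem_edges.1 h
      obtain ⟨hij', hj', hmin'⟩ := mem_edges.1 h'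
      have := hmin i' (hpart ▸ π.mem_part (π.part_nonempty.1 ⟨j, hj'⟩))
      have := hmin' i (hpart ▸ π.mem_part (π.part_nonempty.1 ⟨j, hj⟩))
      omega
    · intro i j j' h h'
      obtain ⟨hij, hj, hmin⟩ := mem_edges.1 h
      obtain ⟨hij', hj', hmin'⟩ := mem_edges.1 h'
      have := hmin j' hj'
      have := hmin' j hj
      omega

theorem part_eq_of_chain (h : ReflTransGen (fun i j => (i, j) ∈ edges π) i j) :
    π.part i = π.part j := by
  induction h with
  | refl => rfl
  | tail _ h ih => exact ih.trans (part_eq_of_mem_edges h)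

theorem chain_of_mem_part (hij : i ≤ j) (hj : j ∈ π.part i) :
    ReflTransGen (fun i j => (i, j) ∈ edges π) i j := by
  induction j using Nat.strong_induction_on with
  | _ j ih =>
  rcases hij.eq_or_lt with rfl | hij
  · exact .refl
  have hi : i ∈ Icc 1 n := π.part_nonempty.1 ⟨j, hj⟩
  obtain ⟨p, hp, hmax⟩ := exists_max_image {k ∈ π.part i | k < j} id
    ⟨i, mem_filter.2 ⟨π.mem_part hi, hij⟩⟩
  obtain ⟨hp, hpj⟩ := mem_filter.1 hp
  have hpart : π.part p = π.part i := π.part_eq_of_mem (π.part_mem.2 hi) hp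
  have hedge : (p, j) ∈ edges π := by
    refine mem_edges.2 ⟨hpj, hpart ▸ hj, fun k hk hpkj => ?_⟩
    exact (hmax k (mem_filter.2 ⟨hpart ▸ hk, hpkj.2⟩)).not_gt hpkj.1
  exact (ih p hpj (hmax i (mem_filter.2 ⟨π.mem_part hi, hij⟩)) hp).tail hedge

theorem le_of_edges_subset (h : edges π ⊆ edges π') : π ≤ π' := by
  intro B hB
  set i := B.min' (π.nonempty_of_mem_parts hB)
  have hiB : i ∈ B := B.min'_mem _
  refine ⟨π'.part i, π'.part_mem.2 (π.le hB hiB), fun j hj => ?_⟩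
  have hchain := chain_of_mem_part (B.min'_le j hj) (π.part_eq_of_mem hB hiB ▸ hj)
  rw [part_eq_of_chain (ReflTransGen.mono (fun _ _ he => h he) _ _ hchain)]
  exact π'.mem_part (π.le hB hj)

theorem edges_injective : Function.Injective (edges (n := n)) := fun _ _ h =>
  le_antisymm (le_of_edges_subset h.le) (le_of_edges_subset h.ge)

end Edges

namespace IsArcSet

variable {n i j : ℕ} {A : Finset (ℕ × ℕ)}

protected theorem mem_Icc (hA : IsArcSet n A) {e : ℕ × ℕ} (he : e ∈ A) :
    e.1 ∈ Icc 1 n ∧ e.2 ∈ Icc 1 n :=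
  mem_product.1 (hA.subset he)

theorem snd_le (hA : IsArcSet n A) {e : ℕ × ℕ} (he : e ∈ A) : e.2 ≤ n :=
  (Finset.mem_Icc.1 (hA.mem_Icc he).2).2

theorem snd_lt_succ (hA : IsArcSet n A) {e : ℕ × ℕ} (he : e ∈ A) : e.2 < n + 1 :=
  Nat.lt_succ_of_le (hA.snd_le he)

theorem notMem_succ (hA : IsArcSet n A) (i : ℕ) : (i, n + 1) ∉ A := fun h =>
  (hA.snd_lt_succ h).false

theorem le_of_chain (hA : IsArcSet n A) (h : ReflTransGen (fun i j => (i, j) ∈ A) i j) :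
    i ≤ j := by
  induction h with
  | refl => exact le_rfl
  | tail _ h ih => exact ih.trans (hA.lt h).le

open Classical in
/-- The partition of `[n]` whose blocks are the maximal chains of arcs. -/
noncomputable def components (hA : IsArcSet n A) : Part n :=
  Finpartition.ofSetSetoid (chainSetoid hA.biUnique) (Icc 1 n)

theorem mem_part_components (hA : IsArcSet n A) (hij : i < j) :
    j ∈ hA.components.part i ↔
      i ∈ Icc 1 n ∧ j ∈ Icc 1 n ∧ ReflTransGen (fun i j => (i, j) ∈ A) i j := by
  classical
  have hchain : ReflTransGen (fun i j => (i, j) ∈ A) i j ↔ chainSetoid hA.biUnique i j :=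
    (or_iff_left fun h => hij.not_ge (hA.le_of_chain h)).symm
  rw [hchain]
  exact Finpartition.mem_part_ofSetSetoid_iff_rel _

theorem edges_components (hA : IsArcSet n A) : edges hA.components = A := by
  ext ⟨i, j⟩
  rw [mem_edges]
  constructor
  · rintro ⟨hij, hj, hmin⟩
    obtain ⟨hi, -, hchain⟩ := (hA.mem_part_components hij).1 hj
    obtain rfl | ⟨p, hip, hpj⟩ := hchain.cases_tail
    · exact absurd hij (lt_irrefl _)
    · obtain rfl | hlt := (hA.le_of_chain hip).eq_or_lt
      · exact hpj
      · have hp : p ∈ Icc 1 n := (hA.mem_Icc hpj).1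
        exact absurd ⟨hlt, hA.lt hpj⟩ (hmin p ((hA.mem_part_components hlt).2 ⟨hi, hp, hip⟩))
  · intro h
    obtain ⟨hi, hj⟩ := hA.mem_Icc h
    refine ⟨hA.lt h, (hA.mem_part_components (hA.lt h)).2 ⟨hi, hj, .single h⟩, ?_⟩
    rintro k hk ⟨hik, hkj⟩
    obtain rfl | ⟨c, hic, hck⟩ := ((hA.mem_part_components hik).1 hk).2.2.cases_head
    · exact lt_irrefl _ hik
    · obtain rfl : c = j := hA.biUnique.2 hic h
      exact hkj.not_ge (hA.le_of_chain hck)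

end IsArcSet

open Classical in
/-- The set of all arc sets on `[n]`. -/
noncomputable def arcSets (n : ℕ) : Finset (Finset (ℕ × ℕ)) :=
  {A ∈ (Icc 1 n ×ˢ Icc 1 n).powerset | IsArcSet n A}

theorem mem_arcSets {n : ℕ} {A : Finset (ℕ × ℕ)} : A ∈ arcSets n ↔ IsArcSet n A := by
  simpa only [arcSets, mem_filter, mem_powerset, and_iff_right_iff_imp] using IsArcSet.subset

theorem arcSets_zero : arcSets 0 = {∅} := by
  ext A
  rw [mem_arcSets, mem_singleton]
  constructor
  · exact fun hA => subset_empty.1 hA.subset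
  · rintro rfl
    exact ⟨empty_subset _, by simp, by simp [Relator.LeftUnique], by simp [Relator.RightUnique]⟩

/-- The number of pairs of arcs `e`, `e'` such that `e'` is open at the endpoint of `e`. -/
def overlaps (A : Finset (ℕ × ℕ)) : ℕ :=
  ∑ e ∈ A, #{e' ∈ A | e'.1 < e.2 ∧ e.2 < e'.2}

theorem cr_add_ne_eq_overlaps {n : ℕ} (π : Part n) : cr π + ne π = overlaps (edges π) := by
  have hA := isArcSet_edges π
  have hcr : cr π = ∑ e ∈ edges π, ∑ e' ∈ edges π,
      if e.1 < e'.1 ∧ e'.1 < e.2 ∧ e.2 < e'.2 then 1 else 0 := by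
    rw [cr, card_filter, sum_product]
  have hne : ne π = ∑ e ∈ edges π, ∑ e' ∈ edges π,
      if e'.1 < e.1 ∧ e.1 < e.2 ∧ e.2 < e'.2 then 1 else 0 := by
    rw [ne, card_filter, sum_product_right]
  simp only [overlaps, hcr, hne, card_filter, ← sum_add_distrib]
  refine sum_congr rfl fun ⟨i, j⟩ he => sum_congr rfl fun ⟨i', j'⟩ he' => ?_
  have hij : i < j := hA.lt he
  have h_unique : i = i' → j = j' := by
    rintro rfl
    exact hA.biUnique.2 he he'
  grind

theorem E_eq_sum_arcSets {R : Type*} [CommRing R] (n : ℕ) (v q : R) :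
    E n v q = ∑ A ∈ arcSets n, q ^ overlaps A * v ^ #A := by
  refine sum_bij (fun π _ => edges π) ?_ ?_ ?_ ?_
  · exact fun π _ => mem_arcSets.2 (isArcSet_edges π)
  · exact fun π _ π' _ h => edges_injective h
  · exact fun A hA => ⟨(mem_arcSets.1 hA).components, mem_univ _, IsArcSet.edges_components _⟩
  · exact fun π _ => by rw [cr_add_ne_eq_overlaps, ed]

/-- The points of `[n]` at which no arc starts, i.e. the maxima of the blocks. -/
def nonOpeners (n : ℕ) (A : Finset (ℕ × ℕ)) : Finset ℕ := Icc 1 n \ A.image Prod.fst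

/-- The number of arcs that end to the right of `i`. -/
def closersAfter (A : Finset (ℕ × ℕ)) (i : ℕ) : ℕ := #{e ∈ A | i < e.2}

theorem mem_nonOpeners {n i : ℕ} {A : Finset (ℕ × ℕ)} :
    i ∈ nonOpeners n A ↔ i ∈ Icc 1 n ∧ ∀ j, (i, j) ∉ A := by
  simp [nonOpeners]

namespace IsArcSet

variable {n i : ℕ} {A : Finset (ℕ × ℕ)}

theorem mono {m : ℕ} (hA : IsArcSet n A) (hnm : n ≤ m) : IsArcSet m A where
  subset := hA.subset.trans (by gcongr)
  lt := hA.lt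
  biUnique := hA.biUnique

theorem restrict (hA : IsArcSet (n + 1) A) : IsArcSet n {e ∈ A | e.2 ≠ n + 1} where
  subset e he := by
    obtain ⟨he, hn⟩ := mem_filter.1 he
    have := hA.lt he
    have := hA.mem_Icc he
    simp only [mem_product, Finset.mem_Icc] at this ⊢
    omega
  lt h := hA.lt (mem_filter.1 h).1
  biUnique :=
    ⟨fun _ _ _ h h' => hA.biUnique.1 (mem_filter.1 h).1 (mem_filter.1 h').1,
      fun _ _ _ h h' => hA.biUnique.2 (mem_filter.1 h).1 (mem_filter.1 h').1⟩

protected theorem insert (hA : IsArcSet n A) (hi : i ∈ nonOpeners n A) :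
    IsArcSet (n + 1) (insert (i, n + 1) A) := by
  obtain ⟨hin, hiA⟩ := mem_nonOpeners.1 hi
  obtain ⟨h1, hn⟩ := Finset.mem_Icc.1 hin
  refine ⟨insert_subset ?_ (hA.mono n.le_succ).subset, ?_, ?_, ?_⟩
  · simp only [mem_product, Finset.mem_Icc]
    omega
  · intro j k h
    rcases mem_insert.1 h with h | h
    · grind
    · exact hA.lt h
  · intro j j' k h h'
    have := @hA.biUnique.1 j j' k
    have := hA.notMem_succ
    grind
  · intro j k k' h h'
    have := @hA.biUnique.2 j k k'
    grind

end IsArcSet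

section Recursion

variable {n i : ℕ} {A : Finset (ℕ × ℕ)}

theorem filter_arcSets_succ (hA : IsArcSet n A) :
    {B ∈ arcSets (n + 1) | ({e ∈ B | e.2 ≠ n + 1} : Finset _) = A} =
      insert A ((nonOpeners n A).image fun i => insert (i, n + 1) A) := by
  have hfilter : ({e ∈ A | e.2 ≠ n + 1} : Finset _) = A :=
    filter_true_of_mem fun e he => (hA.snd_lt_succ he).ne
  ext B
  simp only [mem_filter, mem_arcSets, mem_insert, mem_image]
  constructor
  · rintro ⟨hB, rfl⟩
    by_cases h : ∃ i, (i, n + 1) ∈ B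
    · obtain ⟨i, hi⟩ := h
      refine .inr ⟨i, mem_nonOpeners.2 ⟨?_, fun j hj => ?_⟩, ?_⟩
      · have := hB.lt hi
        have := (hB.mem_Icc hi).1
        simp only [mem_Icc] at this ⊢
        omega
      · obtain ⟨hj, hne⟩ := mem_filter.1 hj
        exact hne (hB.biUnique.2 hj hi)
      · ext ⟨j, k⟩
        have := @hB.biUnique.1 i j (n + 1)
        grind
    · push Not at h
      exact .inl (filter_true_of_mem fun (i, _) he hen => h i (hen ▸ he)).symm
  · rintro (rfl | ⟨i, hi, rfl⟩)
    · exact ⟨hA.mono n.le_succ, hfilter⟩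
    · exact ⟨hA.insert hi, by simpa [filter_insert] using hfilter⟩

theorem sum_arcSets_succ {M : Type*} [AddCommMonoid M] (n : ℕ) (f : Finset (ℕ × ℕ) → M) :
    ∑ B ∈ arcSets (n + 1), f B =
      ∑ A ∈ arcSets n, (f A + ∑ i ∈ nonOpeners n A, f (insert (i, n + 1) A)) := by
  have hmaps : ∀ B ∈ arcSets (n + 1), ({e ∈ B | e.2 ≠ n + 1} : Finset _) ∈ arcSets n :=
    fun B hB => mem_arcSets.2 (mem_arcSets.1 hB).restrict
  rw [← sum_fiberwise_of_maps_to hmaps]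
  refine sum_congr rfl fun A hA => ?_
  have hnotMem := (mem_arcSets.1 hA).notMem_succ
  rw [filter_arcSets_succ (mem_arcSets.1 hA), sum_insert, sum_image]
  · intro i _ i' _ (h : insert (i, n + 1) A = insert (i', n + 1) A)
    have := h ▸ mem_insert_self (i, n + 1) A
    grind
  · simp only [mem_image, not_exists, not_and]
    exact fun i _ h => hnotMem i (h ▸ mem_insert_self _ _)

theorem nonOpeners_succ (hA : IsArcSet n A) :
    nonOpeners (n + 1) A = insert (n + 1) (nonOpeners n A) := by
  have h : n + 1 ∉ A.image Prod.fst := by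
    simp only [mem_image, not_exists, not_and]
    intro e he hen
    have := Finset.mem_Icc.1 (hA.mem_Icc he).1
    omega
  rw [nonOpeners, nonOpeners, ← insert_sdiff_of_notMem _ h,
    insert_Icc_right_eq_Icc_add_one (by omega)]

theorem nonOpeners_insert (j : ℕ) :
    nonOpeners n (insert (i, j) A) = (nonOpeners n A).erase i := by
  rw [nonOpeners, nonOpeners, image_insert, sdiff_insert]

theorem succ_notMem_nonOpeners : n + 1 ∉ nonOpeners n A := fun h => by
  simpa using (mem_nonOpeners.1 h).1

theorem closersAfter_eq_zero (hA : IsArcSet n A) (hi : n ≤ i) : closersAfter A i = 0 :=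
  card_eq_zero.2 (filter_false_of_mem fun _ he => ((hA.snd_le he).trans hi).not_gt)

theorem closersAfter_insert (hA : IsArcSet n A) (i : ℕ) {j : ℕ} (hj : j ≤ n) :
    closersAfter (insert (i, n + 1) A) j = closersAfter A j + 1 := by
  rw [closersAfter, filter_insert, if_pos (by dsimp only; omega), card_insert_of_notMem,
    closersAfter]
  exact fun h => hA.notMem_succ i (mem_filter.1 h).1

theorem overlaps_insert (hA : IsArcSet n A) (i : ℕ) :
    overlaps (insert (i, n + 1) A) = overlaps A + closersAfter A i := by
  have hnew : ∀ e ∈ insert (i, n + 1) A, ¬ n + 1 < e.2 := by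
    have := @IsArcSet.snd_lt_succ n A hA
    grind
  have hold : ∀ e ∈ A, #{e' ∈ insert (i, n + 1) A | e'.1 < e.2 ∧ e.2 < e'.2} =
      #{e' ∈ A | e'.1 < e.2 ∧ e.2 < e'.2} + if i < e.2 then 1 else 0 := by
    intro e he
    have := hA.snd_lt_succ he
    have := hA.notMem_succ i
    rw [filter_insert]
    grind
  rw [overlaps, sum_insert (hA.notMem_succ i), sum_congr rfl hold, sum_add_distrib, ← card_filter,
    filter_false_of_mem fun e he h => hnew e he h.2, card_empty, zero_add, overlaps, closersAfter]

end Recursion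

section GeneratingPolynomial

open Polynomial (derivative)
open scoped Polynomial

variable {R : Type*} [CommSemiring R] (v q : R) {n : ℕ} {A : Finset (ℕ × ℕ)}

theorem derivative_prod_one_add_C_mul_X {ι : Type*} [DecidableEq ι] (s : Finset ι) (x : ι → R) :
    derivative (∏ i ∈ s, (1 + Polynomial.C (x i) * Polynomial.X)) =
      ∑ i ∈ s, Polynomial.C (x i) *
        ∏ j ∈ s.erase i, (1 + Polynomial.C (x j) * Polynomial.X) := by
  rw [Polynomial.derivative_prod_finset]
  refine sum_congr rfl fun i _ => ?_
  rw [Polynomial.derivative_add, Polynomial.derivative_one, Polynomial.derivative_C_mul_X,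
    zero_add, mul_comm]

/-- The generating polynomial of the sets of points that open no arc of `A`. Such a set `S` marks
the origins of arcs that will be closed to the right of `n`; it has weight
`q ^ ∑ i ∈ S, closersAfter A i`, which counts the pairs of one of these arcs and an arc of `A` that
will cross or nest, and the variable counts the elements of `S`. -/
noncomputable def markPoly (n : ℕ) (A : Finset (ℕ × ℕ)) : R[X] :=
  ∏ i ∈ nonOpeners n A, (1 + Polynomial.C (q ^ closersAfter A i) * Polynomial.X)

/-- The generating polynomial of the arc sets on `[n]` with a set of marked points that open no
arc. Its value at `0` is `E n v q`. -/
noncomputable def totalPoly (n : ℕ) : R[X] :=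
  ∑ A ∈ arcSets n, Polynomial.C (q ^ overlaps A * v ^ #A) * markPoly q n A

theorem markPoly_succ (hA : IsArcSet n A) :
    markPoly q (n + 1) A = (1 + Polynomial.X) * markPoly q n A := by
  rw [markPoly, nonOpeners_succ hA, prod_insert succ_notMem_nonOpeners,
    closersAfter_eq_zero hA n.le_succ, pow_zero, map_one, one_mul, markPoly]

theorem markPoly_insert (hA : IsArcSet n A) {i : ℕ} (hi : i ∈ nonOpeners n A) :
    markPoly q (n + 1) (insert (i, n + 1) A) = (1 + Polynomial.X) *
      (∏ j ∈ (nonOpeners n A).erase i,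
        (1 + Polynomial.C (q ^ closersAfter A j) * Polynomial.X)).comp
          (Polynomial.C q * Polynomial.X) := by
  have hi_ne : i ≠ n + 1 := by
    rintro rfl
    exact succ_notMem_nonOpeners hi
  have hnew : closersAfter (insert (i, n + 1) A) (n + 1) = 0 :=
    closersAfter_eq_zero (hA.insert hi) le_rfl
  have hold : ∀ j ∈ (nonOpeners n A).erase i,
      closersAfter (insert (i, n + 1) A) j = closersAfter A j + 1 := fun j hj =>
    closersAfter_insert hA i (mem_Icc.1 (mem_nonOpeners.1 (mem_of_mem_erase hj)).1).2
  rw [markPoly, nonOpeners_insert, nonOpeners_succ hA, erase_insert_of_ne hi_ne.symm,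
    prod_insert fun h => succ_notMem_nonOpeners (mem_of_mem_erase h), hnew, Polynomial.prod_comp,
    pow_zero, map_one, one_mul]
  congr 1
  refine prod_congr rfl fun j hj => ?_
  simp only [hold j hj, pow_succ, map_mul, mul_assoc, Polynomial.add_comp, Polynomial.one_comp,
    Polynomial.mul_comp, Polynomial.C_comp, Polynomial.X_comp]

/-- Closing the arc from a marked point amounts to removing the mark, hence the derivative, and
lets every other marked arc cross or nest with one more arc, hence the substitution. -/
theorem sum_markPoly_insert (hA : IsArcSet n A) :
    ∑ i ∈ nonOpeners n A,
        Polynomial.C (q ^ closersAfter A i) * markPoly q (n + 1) (insert (i, n + 1) A) =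
      (1 + Polynomial.X) *
        (derivative (markPoly q n A)).comp (Polynomial.C q * Polynomial.X) := by
  rw [markPoly, derivative_prod_one_add_C_mul_X, Polynomial.sum_comp, mul_sum]
  refine sum_congr rfl fun i hi => ?_
  rw [markPoly_insert q hA hi, Polynomial.mul_comp, Polynomial.C_comp, mul_left_comm]

theorem totalPoly_zero : totalPoly v q 0 = 1 := by
  simp [totalPoly, arcSets_zero, overlaps, markPoly, nonOpeners]

theorem totalPoly_succ (n : ℕ) : totalPoly v q (n + 1) = (1 + Polynomial.X) *
    (totalPoly v q n + Polynomial.C v *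
      (derivative (totalPoly v q n)).comp (Polynomial.C q * Polynomial.X)) := by
  have hclose : ∀ A ∈ arcSets n, ∑ i ∈ nonOpeners n A,
      Polynomial.C (q ^ overlaps (insert (i, n + 1) A) * v ^ #(insert (i, n + 1) A)) *
        markPoly q (n + 1) (insert (i, n + 1) A) =
      Polynomial.C v * Polynomial.C (q ^ overlaps A * v ^ #A) * ((1 + Polynomial.X) *
        (derivative (markPoly q n A)).comp (Polynomial.C q * Polynomial.X)) := by
    intro A hA
    rw [mem_arcSets] at hA
    rw [← sum_markPoly_insert q hA, mul_sum]
    refine sum_congr rfl fun i _ => ?_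
    rw [overlaps_insert hA, card_insert_of_notMem (hA.notMem_succ i)]
    simp only [map_mul, map_pow]
    ring
  rw [totalPoly, sum_arcSets_succ, sum_add_distrib, sum_congr rfl hclose, totalPoly]
  simp only [Polynomial.derivative_sum, Polynomial.derivative_C_mul, Polynomial.sum_comp,
    Polynomial.mul_comp, Polynomial.C_comp, mul_add, mul_sum]
  congr 1
  · refine sum_congr rfl fun A hA => ?_
    rw [markPoly_succ q (mem_arcSets.1 hA), mul_left_comm]
  · refine sum_congr rfl fun A _ => ?_
    ring

theorem coeff_totalPoly (n k : ℕ) : (totalPoly v q n).coeff k =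
    JFraction.motzkin (fun k => 1 + (k : R) * q ^ (k - 1) * v)
      (fun k => ((k : R) + 1) * q ^ k * v) n k := by
  induction n generalizing k with
  | zero => cases k <;> simp [totalPoly_zero, JFraction.motzkin, Polynomial.coeff_one]
  | succ n ih =>
    rw [totalPoly_succ]
    cases k <;>
      simp only [add_mul, one_mul, Polynomial.coeff_add, Polynomial.coeff_X_mul_zero,
        Polynomial.coeff_X_mul, Polynomial.coeff_C_mul, Polynomial.comp_C_mul_X_coeff,
        Polynomial.coeff_derivative, ih, JFraction.motzkin, Nat.add_sub_cancel] <;>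
      push_cast <;> ring

end GeneratingPolynomial

theorem E_eq_coeff_totalPoly {R : Type*} [CommRing R] (v q : R) (n : ℕ) :
    E n v q = (totalPoly v q n).coeff 0 := by
  simp [E_eq_sum_arcSets, totalPoly, markPoly, Polynomial.coeff_zero_eq_eval_zero,
    Polynomial.eval_finsetSum, Polynomial.eval_prod]

end SetPartition

/-- For `k = 0` the factor `q ^ (k - 1)` is multiplied by `k = 0`, so the first denominator
is `1 - z`. -/
theorem mainTheorem9 {R : Type*} [CommRing R] (v q : R) :
    JFraction.HasJFraction (PowerSeries.mk fun n => SetPartition.E n v q)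
      (fun k => 1 + (k : R) * q ^ (k - 1) * v)
      (fun k => ((k : R) + 1) * q ^ k * v) := by
  simp only [SetPartition.E_eq_coeff_totalPoly, SetPartition.coeff_totalPoly]
  exact JFraction.hasJFraction_motzkin _ _
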